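/- For integers $m,n$ let $\tau_{m,n}$ be the translation $(x,y)\mapsto(x+m,y+n)$ of the Euclidean plane and let $\sigma$ be the glide reflection $(x,y)\mapsto(x+\tfrac12,-y)$. Let $G$ be the (discrete) wallpaper group generated by $\sigma$ and all $\tau_{m,n}$; thus $G=\{\tau_{m,n},\ \sigma\tau_{m,n} : (m,n)\in\mathbb Z^2\}$ with $\sigma\tau_{m,-n}=\tau_{m,n}\sigma$ and $\sigma^2=\tau_{1,0}$. Let $C^*(G)$ be its full group $C^*$-algebra, i.e. the completion of $\mathbb C[G]$ in the norm $\|f\|=\sup_\pi\|\pi(f)\|$, where $\pi$ runs over all unitary representations of $G$ on Hilbert spaces, and let $\mathcal Z$ be the center of $C^*(G)$. A $C^*$-algebra $A$ with center $\mathcal Z(A)$ is called weakly central if the map $M\mapsto M\cap\mathcal Z(A)$ is injective on the set of maximal modular (two-sided) ideals of $A$ and no maximal modular ideal of $A$ contains $\mathcal Z(A)$. Then $C^*(G)$ is not weakly central. More precisely, for every $\alpha\in\mathbb C$ with $|\alpha|=1$ there are two one-dimensional representations (unital $*$-homomorphisms) $\pi_1,\pi_2\colon C^*(G)\to\mathbb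 C$ with $\pi_1(\sigma)=\alpha$ and $\pi_2(\sigma)=-\alpha$ whose kernels are distinct maximal modular ideals of $C^*(G)$, such that $$\ker\pi_1\cap\mathcal Z=\ker\pi_2\cap\mathcal Z ,$$ and this intersection is a maximal ideal of $\mathcal Z$. -/

import Mathlib

noncomputable section

universe u

/-! ### The full group C⋆-algebra of a discrete group -/

/-- The complex group algebra `ℂ[G]`; a type synonym that carries the involution and the
maximal C⋆-seminorm. -/
def GroupAlg (G : Type u) [Group G] : Type u := MonoidAlgebra ℂ G

namespace GroupAlg

variable {G : Type u} [Group G]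

instance : Ring (GroupAlg G) := inferInstanceAs (Ring (MonoidAlgebra ℂ G))

instance : Algebra ℂ (GroupAlg G) := inferInstanceAs (Algebra ℂ (MonoidAlgebra ℂ G))

/-- The inclusion of the group into its group algebra. -/
def of : G →* GroupAlg G := MonoidAlgebra.of ℂ G

theorem induction_smul_of {p : GroupAlg G → Prop} (f : GroupAlg G) (zero : p 0)
    (smul_of : ∀ (c : ℂ) (g : G), p (c • of g))
    (add : ∀ f₁ f₂, p f₁ → p f₂ → p (f₁ + f₂)) : p f := by
  refine MonoidAlgebra.induction_linear (motive := p) f zero add ?_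
  intro g c
  have : (MonoidAlgebra.single g c : MonoidAlgebra ℂ G) = c • MonoidAlgebra.of ℂ G g := by simp
  rw [this]
  exact smul_of c g

/-- The involution `(∑ c_g g)⋆ = ∑ conj(c_g) g⁻¹`. -/
instance : Star (GroupAlg G) where
  star f := (MonoidAlgebra.coeff f).sum fun g c => star c • of g⁻¹

theorem star_smul_of (c : ℂ) (g : G) : star (c • of g : GroupAlg G) = star c • of g⁻¹ := by
  have h : MonoidAlgebra.coeff (c • of g : GroupAlg G) = Finsupp.single g c := by
    change MonoidAlgebra.coeff (c • MonoidAlgebra.of ℂ G g) = _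
    simp
  change (MonoidAlgebra.coeff (c • of g : GroupAlg G)).sum _ = _
  rw [h]
  exact Finsupp.sum_single_index (by simp)

theorem star_add_aux (f₁ f₂ : GroupAlg G) : star (f₁ + f₂) = star f₁ + star f₂ := by
  classical
  have h : MonoidAlgebra.coeff (f₁ + f₂) = MonoidAlgebra.coeff f₁ + MonoidAlgebra.coeff f₂ := rfl
  change (MonoidAlgebra.coeff (f₁ + f₂)).sum _ = _
  rw [h]
  exact Finsupp.sum_add_index' (by simp) (by simp [add_smul])

theorem star_zero_aux : star (0 : GroupAlg G) = 0 := Finsupp.sum_zero_index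

instance : StarRing (GroupAlg G) where
  star_add := star_add_aux
  star_involutive f := by
    induction f using induction_smul_of with
    | zero => simp only [star_zero_aux]
    | smul_of c g => simp only [star_smul_of, star_star, inv_inv]
    | add f₁ f₂ h₁ h₂ => simp only [star_add_aux, h₁, h₂]
  star_mul f₁ f₂ := by
    induction f₁ using induction_smul_of with
    | zero => simp only [star_zero_aux, zero_mul, mul_zero]
    | add a b ha hb => simp only [star_add_aux, add_mul, mul_add, ha, hb]
    | smul_of c g =>
      induction f₂ using induction_smul_of with
      | zero => simp only [star_zero_aux, zero_mul, mul_zero]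
      | add a b ha hb => simp only [star_add_aux, add_mul, mul_add, ha, hb]
      | smul_of d h =>
        rw [smul_mul_smul_comm, ← map_mul, star_smul_of, star_smul_of, star_smul_of,
          smul_mul_smul_comm, ← map_mul, mul_inv_rev, star_mul]

instance : StarModule ℂ (GroupAlg G) where
  star_smul c f := by
    induction f using induction_smul_of with
    | zero => simp only [star_zero, smul_zero]
    | smul_of d g => rw [smul_smul, star_smul_of, star_smul_of, smul_smul, star_mul']
    | add a b ha hb => simp only [star_add, smul_add, ha, hb]

section Rep

variable {H : Type u} [NormedAddCommGroup H] [InnerProductSpace ℂ H] [CompleteSpace H]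

/-- The linear extension to `ℂ[G]` of a unitary representation `π` of `G` on a Hilbert space. -/
def rep (π : G →* unitary (H →L[ℂ] H)) : GroupAlg G →ₐ[ℂ] (H →L[ℂ] H) :=
  MonoidAlgebra.lift ℂ (H →L[ℂ] H) G ((unitary (H →L[ℂ] H)).subtype.comp π)

theorem rep_of (π : G →* unitary (H →L[ℂ] H)) (g : G) : rep π (of g) = (π g : H →L[ℂ] H) :=
  MonoidAlgebra.lift_of _ _

theorem rep_star (π : G →* unitary (H →L[ℂ] H)) (f : GroupAlg G) :
    rep π (star f) = star (rep π f) := by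
  induction f using induction_smul_of with
  | zero => simp only [star_zero, map_zero]
  | smul_of c g =>
    rw [star_smul_of, map_smul, map_smul, rep_of, rep_of, star_smul, map_inv,
      ← Unitary.star_eq_inv, Unitary.coe_star]
  | add a b ha hb => simp only [star_add, map_add, ha, hb]

end Rep

/-- The set of all numbers `‖π(f)‖`, where `π` runs over the unitary representations of `G` on
Hilbert spaces. -/
def repNorms (f : GroupAlg G) : Set ℝ :=
  {r | ∃ (H : Type u) (_ : NormedAddCommGroup H) (_ : InnerProductSpace ℂ H)
    (_ : CompleteSpace H) (π : G →* unitary (H →L[ℂ] H)), r = ‖rep π f‖}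

theorem repNorms_bddAbove (f : GroupAlg G) : BddAbove (repNorms f) := by
  induction f using induction_smul_of with
  | zero =>
    refine ⟨0, ?_⟩
    rintro _ ⟨H, _, _, _, π, rfl⟩
    simp
  | smul_of c g =>
    refine ⟨‖c‖, ?_⟩
    rintro _ ⟨H, _, _, _, π, rfl⟩
    rw [map_smul, rep_of, norm_smul]
    have : ‖(π g : H →L[ℂ] H)‖ ≤ 1 := by
      rcases subsingleton_or_nontrivial (H →L[ℂ] H) with h | h
      · rw [Subsingleton.elim (π g : H →L[ℂ] H) 0]; simp
      · exact (CStarRing.norm_coe_unitary (π g)).le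
    exact mul_le_of_le_one_right (norm_nonneg _) this
  | add a b ha hb =>
    obtain ⟨A, hA⟩ := ha
    obtain ⟨B, hB⟩ := hb
    refine ⟨A + B, ?_⟩
    rintro _ ⟨H, _, _, _, π, rfl⟩
    rw [map_add]
    exact (norm_add_le _ _).trans (add_le_add (hA ⟨H, _, _, _, π, rfl⟩) (hB ⟨H, _, _, _, π, rfl⟩))

/-- The maximal C⋆-seminorm `‖f‖ = sup_π ‖π(f)‖` on the group algebra. -/
instance : Norm (GroupAlg G) where
  norm f := sSup (repNorms f)

theorem norm_rep_le {H : Type u} [NormedAddCommGroup H] [InnerProductSpace ℂ H] [CompleteSpace H]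
    (π : G →* unitary (H →L[ℂ] H)) (f : GroupAlg G) : ‖rep π f‖ ≤ ‖f‖ :=
  le_csSup (repNorms_bddAbove f) ⟨H, _, _, _, π, rfl⟩

theorem norm_nonneg_aux (f : GroupAlg G) : 0 ≤ ‖f‖ := by
  refine Real.sSup_nonneg ?_
  rintro _ ⟨H, _, _, _, π, rfl⟩
  exact norm_nonneg _

theorem norm_le_aux {f : GroupAlg G} {C : ℝ} (hC : 0 ≤ C)
    (h : ∀ (H : Type u) [NormedAddCommGroup H] [InnerProductSpace ℂ H] [CompleteSpace H]
      (π : G →* unitary (H →L[ℂ] H)), ‖rep π f‖ ≤ C) : ‖f‖ ≤ C := by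
  refine Real.sSup_le ?_ hC
  rintro _ ⟨H, _, _, _, π, rfl⟩
  exact h H π

theorem norm_mul_le_aux (f₁ f₂ : GroupAlg G) : ‖f₁ * f₂‖ ≤ ‖f₁‖ * ‖f₂‖ := by
  refine norm_le_aux (mul_nonneg (norm_nonneg_aux _) (norm_nonneg_aux _)) fun H _ _ _ π => ?_
  rw [map_mul]
  exact (norm_mul_le _ _).trans (mul_le_mul (norm_rep_le π _) (norm_rep_le π _)
    (norm_nonneg _) (norm_nonneg_aux _))

theorem norm_star_aux (f : GroupAlg G) : ‖star f‖ ≤ ‖f‖ := by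
  refine norm_le_aux (norm_nonneg_aux _) fun H _ _ _ π => ?_
  rw [rep_star, norm_star]
  exact norm_rep_le π f

/-- The seminorm axioms of `sup_π ‖π(f)‖`. -/
def core : AddGroupSeminorm (GroupAlg G) where
  toFun f := ‖f‖
  map_zero' := le_antisymm (norm_le_aux le_rfl fun H _ _ _ π => by simp) (norm_nonneg_aux _)
  add_le' f₁ f₂ := by
    refine norm_le_aux (add_nonneg (norm_nonneg_aux _) (norm_nonneg_aux _)) fun H _ _ _ π => ?_
    rw [map_add]
    exact (norm_add_le _ _).trans (add_le_add (norm_rep_le π _) (norm_rep_le π _))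
  neg' f := by
    have h : repNorms (-f) = repNorms f := by
      ext r
      simp only [repNorms, map_neg, norm_neg]
    exact congrArg sSup h

instance : SeminormedRing (GroupAlg G) where
  __ := (inferInstance : Ring (GroupAlg G))
  toNorm := inferInstance
  __ := core.toSeminormedAddCommGroup
  norm_mul_le := norm_mul_le_aux

instance : NormedAlgebra ℂ (GroupAlg G) where
  norm_smul_le c f := by
    refine norm_le_aux (mul_nonneg (norm_nonneg _) (norm_nonneg_aux _)) fun H _ _ _ π => ?_
    rw [map_smul, norm_smul]
    exact mul_le_mul_of_nonneg_left (norm_rep_le π f) (norm_nonneg _)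

instance : NormedStarGroup (GroupAlg G) where
  norm_star_le := norm_star_aux

theorem norm_mul_self_le_aux (f : GroupAlg G) : ‖f‖ * ‖f‖ ≤ ‖star f * f‖ := by
  have h : ‖f‖ ≤ Real.sqrt ‖star f * f‖ := by
    refine norm_le_aux (Real.sqrt_nonneg _) fun H _ _ _ π => ?_
    refine Real.le_sqrt_of_sq_le ?_
    rw [sq, ← CStarRing.norm_star_mul_self, ← rep_star, ← map_mul]
    exact norm_rep_le π _
  calc ‖f‖ * ‖f‖ ≤ Real.sqrt ‖star f * f‖ * Real.sqrt ‖star f * f‖ :=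
        mul_self_le_mul_self (norm_nonneg _) h
    _ = ‖star f * f‖ := Real.mul_self_sqrt (norm_nonneg _)

end GroupAlg

/-- The full group C⋆-algebra `C⋆(G)` of a discrete group `G`: the (Hausdorff) completion of
`ℂ[G]` for the norm `‖f‖ = sup_π ‖π(f)‖`, `π` running over the unitary representations of `G`. -/
def FullGroupCStar (G : Type u) [Group G] : Type u := UniformSpace.Completion (GroupAlg G)

namespace FullGroupCStar

open UniformSpace

variable {G : Type u} [Group G]

instance : NormedRing (FullGroupCStar G) :=
  inferInstanceAs (NormedRing (Completion (GroupAlg G)))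

instance : CompleteSpace (FullGroupCStar G) :=
  inferInstanceAs (CompleteSpace (Completion (GroupAlg G)))

instance : Algebra ℂ (FullGroupCStar G) :=
  inferInstanceAs (Algebra ℂ (Completion (GroupAlg G)))

/-- The canonical map `ℂ[G] → C⋆(G)`. -/
def incl : GroupAlg G →+* FullGroupCStar G := Completion.coeRingHom

theorem norm_incl (f : GroupAlg G) : ‖incl f‖ = ‖f‖ := Completion.norm_coe f

theorem incl_smul (c : ℂ) (f : GroupAlg G) : incl (c • f) = c • incl f := Completion.coe_smul c f

theorem denseRange_incl : DenseRange (incl : GroupAlg G → FullGroupCStar G) :=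
  Completion.denseRange_coe

instance : NormedAlgebra ℂ (FullGroupCStar G) where
  norm_smul_le c x := norm_smul_le (β := Completion (GroupAlg G)) c x

/-- The involution of `C⋆(G)`, the continuous extension of that of `ℂ[G]`. -/
instance : Star (FullGroupCStar G) where
  star := Completion.map (star : GroupAlg G → GroupAlg G)

theorem star_incl (f : GroupAlg G) : star (incl f) = incl (star f) :=
  Completion.map_coe star_isometry.uniformContinuous f

theorem continuous_star_aux : Continuous (star : FullGroupCStar G → FullGroupCStar G) :=
  Completion.continuous_map

instance : StarRing (FullGroupCStar G) where
  star_involutive x := by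
    refine denseRange_incl.induction_on (p := fun x => star (star x) = x) x ?_ fun f => ?_
    · exact isClosed_eq (continuous_star_aux.comp continuous_star_aux) continuous_id
    · rw [star_incl, star_incl, star_star]
  star_mul x y := by
    refine denseRange_incl.induction_on₂ (p := fun x y => star (x * y) = star y * star x)
      ?_ (fun f g => ?_) x y
    · exact isClosed_eq (continuous_star_aux.comp continuous_mul)
        ((continuous_star_aux.comp continuous_snd).mul (continuous_star_aux.comp continuous_fst))
    · rw [← map_mul, star_incl, star_incl, star_incl, star_mul, map_mul]
  star_add x y := by
    refine denseRange_incl.induction_on₂ (p := fun x y => star (x + y) = star x + star y)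
      ?_ (fun f g => ?_) x y
    · exact isClosed_eq (continuous_star_aux.comp continuous_add)
        ((continuous_star_aux.comp continuous_fst).add (continuous_star_aux.comp continuous_snd))
    · rw [← map_add, star_incl, star_incl, star_incl, star_add, map_add]

instance : StarModule ℂ (FullGroupCStar G) where
  star_smul c x := by
    refine denseRange_incl.induction_on (p := fun x => star (c • x) = star c • star x) x ?_
      fun f => ?_
    · exact isClosed_eq (continuous_star_aux.comp (continuous_const_smul c))
        (continuous_star_aux.const_smul (star c))
    · rw [← incl_smul, star_incl, star_incl, star_smul, incl_smul]

instance : CStarRing (FullGroupCStar G) where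
  norm_mul_self_le x := by
    refine denseRange_incl.induction_on (p := fun x => ‖x‖ * ‖x‖ ≤ ‖star x * x‖) x ?_
      fun f => ?_
    · exact isClosed_le (continuous_norm.mul continuous_norm)
        (continuous_norm.comp (continuous_star_aux.mul continuous_id))
    · rw [star_incl, ← map_mul, norm_incl, norm_incl]
      exact GroupAlg.norm_mul_self_le_aux f

instance : CStarAlgebra (FullGroupCStar G) where

/-- The canonical homomorphism of `G` into `C⋆(G)`, `g ↦ δ_g`. -/
def of : G →* FullGroupCStar G := (incl (G := G)).toMonoidHom.comp GroupAlg.of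

end FullGroupCStar

/-! ### Weak centrality -/

section WeaklyCentral

variable {A : Type u} [NonUnitalCStarAlgebra A]

/-- A two-sided ideal `I` is modular if `A / I` has a unit, the class of some `e`. -/
def TwoSidedIdeal.IsModular (I : TwoSidedIdeal A) : Prop :=
  ∃ e : A, ∀ a : A, a - e * a ∈ I ∧ a - a * e ∈ I

/-- The elements of `Max(A)`: modular two-sided ideals that are maximal among the proper
two-sided ideals (such ideals are automatically closed). -/
def TwoSidedIdeal.IsMaximalModular (I : TwoSidedIdeal A) : Prop :=
  I.IsModular ∧ IsCoatom I

variable (A) in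
/-- A C⋆-algebra is weakly central if `M ↦ M ∩ Z(A)` is injective on `Max(A)` and no element of
`Max(A)` contains the center `Z(A)`. -/
def IsWeaklyCentral : Prop :=
  (∀ M N : TwoSidedIdeal A, M.IsMaximalModular → N.IsMaximalModular →
    (M : Set A) ∩ Set.center A = (N : Set A) ∩ Set.center A → M = N) ∧
  ∀ M : TwoSidedIdeal A, M.IsMaximalModular → ¬ Set.center A ⊆ (M : Set A)

end WeaklyCentral

/-! ### The wallpaper group; the Euclidean plane is `ℂ` -/

namespace Wallpaper

/-- The translation `τ_{m,n}` of the plane by the vector `(m, n)`. -/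
def translation (m n : ℤ) : ℂ ≃ᵢ ℂ := IsometryEquiv.addRight (m + n * Complex.I : ℂ)

/-- The glide reflection `(x, y) ↦ (x + 1/2, -y)` of the plane. -/
def glide : ℂ ≃ᵢ ℂ :=
  Complex.conjLIE.toIsometryEquiv.trans (IsometryEquiv.addRight (1 / 2 : ℂ))

/-- The crystallographic group generated by the integer translations and the glide reflection. -/
def group : Subgroup (ℂ ≃ᵢ ℂ) :=
  Subgroup.closure (insert glide (Set.range fun v : ℤ × ℤ => translation v.1 v.2))

/-- The glide reflection as an element of the group. -/
def σ : group := ⟨glide, Subgroup.subset_closure (Set.mem_insert _ _)⟩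

/-- The translation `τ_{m,n}` as an element of the group. -/
def τ (m n : ℤ) : group :=
  ⟨translation m n, Subgroup.subset_closure (Set.mem_insert_of_mem _ ⟨(m, n), rfl⟩)⟩

theorem translation_apply (m n : ℤ) (z : ℂ) : translation m n z = z + (m + n * Complex.I) := rfl

theorem glide_apply (z : ℂ) : glide z = (starRingEnd ℂ) z + 1 / 2 := rfl

theorem τ_mul_τ (m n m' n' : ℤ) : τ m n * τ m' n' = τ (m + m') (n + n') := by
  ext z
  change translation m n (translation m' n' z) = translation (m + m') (n + n') z
  simp only [translation_apply]
  push_cast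
  ring

theorem σ_mul_τ (m n : ℤ) : σ * τ m (-n) = τ m n * σ := by
  ext z
  change glide (translation m (-n) z) = translation m n (glide z)
  simp only [translation_apply, glide_apply]
  simp
  ring

theorem σ_sq : σ ^ 2 = τ 1 0 := by
  rw [sq]
  ext z
  change glide (glide z) = translation 1 0 z
  simp only [translation_apply, glide_apply]
  simp only [map_add, map_div₀, map_one, map_ofNat, Complex.conj_conj]
  push_cast
  ring

/-- `G = {τ_{m,n}, σ τ_{m,n} : m, n ∈ ℤ}`. -/
theorem eq_τ_or_eq_σ_mul_τ (g : group) : ∃ m n : ℤ, g = τ m n ∨ g = σ * τ m n := by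
  have τ_inv (m n : ℤ) : (τ m n)⁻¹ = τ (-m) (-n) := by
    rw [inv_eq_iff_mul_eq_one, τ_mul_τ]
    ext z
    change translation (m + -m) (n + -n) z = z
    simp [translation_apply]
  have τ_mul_σ (m n : ℤ) : τ m n * σ = σ * τ m (-n) := (σ_mul_τ m n).symm
  have σσ : σ * σ = τ 1 0 := by rw [← sq, σ_sq]
  have σ_inv : σ⁻¹ = σ * τ (-1) 0 := by
    rw [inv_eq_iff_mul_eq_one, ← mul_assoc, σσ, τ_mul_τ]
    ext z
    change translation (1 + -1) (0 + 0) z = z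
    simp [translation_apply]
  obtain ⟨g, hg⟩ := g
  induction hg using Subgroup.closure_induction with
  | mem x hx =>
    rcases hx with rfl | ⟨⟨m, n⟩, rfl⟩
    · refine ⟨0, 0, Or.inr ?_⟩
      ext z
      change glide z = glide (translation 0 0 z)
      simp [translation_apply]
    · exact ⟨m, n, Or.inl rfl⟩
  | one =>
    refine ⟨0, 0, Or.inl ?_⟩
    ext z
    change z = translation 0 0 z
    simp [translation_apply]
  | mul x y hx hy ihx ihy =>
    obtain ⟨m, n, h⟩ := ihx
    obtain ⟨m', n', h'⟩ := ihy
    have key : (⟨x * y, mul_mem hx hy⟩ : group) = ⟨x, hx⟩ * ⟨y, hy⟩ := rfl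
    change ∃ m n : ℤ, (⟨x * y, mul_mem hx hy⟩ : group) = τ m n ∨ _ = σ * τ m n
    rw [key]
    rcases h with h | h <;> rcases h' with h' | h' <;> rw [h, h']
    · exact ⟨_, _, Or.inl (τ_mul_τ _ _ _ _)⟩
    · exact ⟨_, _, Or.inr (by rw [← mul_assoc, τ_mul_σ, mul_assoc, τ_mul_τ])⟩
    · exact ⟨_, _, Or.inr (by rw [mul_assoc, τ_mul_τ])⟩
    · exact ⟨_, _, Or.inl (by
        rw [mul_assoc, ← mul_assoc (τ m n), τ_mul_σ, mul_assoc, τ_mul_τ, ← mul_assoc, σσ,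
          τ_mul_τ])⟩
  | inv x hx ih =>
    obtain ⟨m, n, h⟩ := ih
    have key : (⟨x⁻¹, inv_mem hx⟩ : group) = (⟨x, hx⟩ : group)⁻¹ := rfl
    change ∃ m n : ℤ, (⟨x⁻¹, inv_mem hx⟩ : group) = τ m n ∨ _ = σ * τ m n
    rw [key]
    rcases h with h | h <;> rw [h]
    · exact ⟨_, _, Or.inl (τ_inv _ _)⟩
    · exact ⟨_, _, Or.inr (by
        rw [mul_inv_rev, τ_inv, σ_inv, ← mul_assoc, τ_mul_σ, mul_assoc, τ_mul_τ])⟩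

end Wallpaper

end

/-! The character `τ_{m,n} ↦ α²ᵐ wⁿ` of the translation group induces a two-dimensional
representation of `G`, in which `τ_{0,1}` acts by `diag(w, w̄)` and `σ` swaps the two coordinate
lines. For `w ≠ w̄` only diagonal matrices commute with `diag(w, w̄)`, so central elements act
diagonally. Letting `w → 1` along the circle, the lower left entry of a central element still
vanishes at `w = 1` (`rep_one_lowerEntry`). At `w = 1` the representation is reducible: `(β, 1)`
with `β = ±α` spans an invariant line on which `σ` acts by `β` (`rep_one_mulVec`). The second
coordinate of the eigenvalue equation shows that a central element has the same eigenvalue on both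
lines, its lower right entry (`character_eq_rep`). So the characters `σ ↦ α` and `σ ↦ -α` agree on
the center, although `σ` itself separates their kernels. -/

noncomputable section

/-! ### Universal property of `C⋆(G)` and continuity in parameters -/

namespace FullGroupCStar

open UniformSpace

variable {G : Type u} [Group G]
variable {B : Type*} [CStarAlgebra B]
variable {H : Type u} [NormedAddCommGroup H] [InnerProductSpace ℂ H] [CompleteSpace H]

/-- The linear extension to `ℂ[G]` of a homomorphism into the unitary group of a C⋆-algebra. -/
def liftGroupAlg (v : G →* unitary B) : GroupAlg G →ₐ[ℂ] B :=
  MonoidAlgebra.lift ℂ B G ((unitary B).subtype.comp v)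

theorem liftGroupAlg_of (v : G →* unitary B) (g : G) :
    liftGroupAlg v (GroupAlg.of g) = (v g : B) :=
  MonoidAlgebra.lift_of _ _

theorem liftGroupAlg_star (v : G →* unitary B) (f : GroupAlg G) :
    liftGroupAlg v (star f) = star (liftGroupAlg v f) := by
  induction f using GroupAlg.induction_smul_of with
  | zero => simp only [star_zero, map_zero]
  | smul_of c g =>
    rw [GroupAlg.star_smul_of, map_smul, map_smul, liftGroupAlg_of, liftGroupAlg_of, star_smul,
      map_inv, ← Unitary.star_eq_inv, Unitary.coe_star]
  | add a b ha hb => simp only [star_add, map_add, ha, hb]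

/-- Composed with the isometric `Φ`, `v` becomes a unitary representation on `H`, one of those over
which the norm of `ℂ[G]` is a supremum. -/
theorem norm_liftGroupAlg_le (Φ : B →⋆ₐ[ℂ] (H →L[ℂ] H)) (hΦ : ∀ b, ‖Φ b‖ = ‖b‖)
    (v : G →* unitary B) (f : GroupAlg G) : ‖liftGroupAlg v f‖ ≤ ‖f‖ := by
  have h : Φ (liftGroupAlg v f) =
      GroupAlg.rep ((Unitary.map ⟨(Φ : B →* (H →L[ℂ] H)), map_star Φ⟩).toMonoidHom.comp v) f := by
    induction f using GroupAlg.induction_smul_of with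
    | zero => simp only [map_zero]
    | smul_of c g =>
      rw [map_smul, map_smul, map_smul, liftGroupAlg_of, GroupAlg.rep_of]
      rfl
    | add a b ha hb => simp only [map_add, ha, hb]
  rw [← hΦ, h]
  exact GroupAlg.norm_rep_le _ f

theorem continuous_liftGroupAlg (Φ : B →⋆ₐ[ℂ] (H →L[ℂ] H)) (hΦ : ∀ b, ‖Φ b‖ = ‖b‖)
    (v : G →* unitary B) : Continuous (liftGroupAlg v).toRingHom :=
  AddMonoidHomClass.continuous_of_bound (liftGroupAlg v) 1 fun f => by
    simpa using norm_liftGroupAlg_le Φ hΦ v f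

/-- The continuous extension to `C⋆(G)` of the linear extension of `v : G →* unitary B`. -/
def liftRingHom (v : G →* unitary B) (hv : Continuous (liftGroupAlg v).toRingHom) :
    FullGroupCStar G →+* B :=
  Completion.extensionHom (liftGroupAlg v).toRingHom hv

theorem liftRingHom_incl (v : G →* unitary B) (hv : Continuous (liftGroupAlg v).toRingHom)
    (f : GroupAlg G) : liftRingHom v hv (incl f) = liftGroupAlg v f :=
  Completion.extensionHom_coe _ hv f

theorem continuous_liftRingHom (v : G →* unitary B)
    (hv : Continuous (liftGroupAlg v).toRingHom) : Continuous (liftRingHom v hv) :=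
  Completion.continuous_extension

/-- The extension to `C⋆(G)` of a homomorphism `v` of `G` into the unitary group of a C⋆-algebra
`B` that is represented faithfully on a Hilbert space by `Φ`. -/
def lift (Φ : B →⋆ₐ[ℂ] (H →L[ℂ] H)) (hΦ : ∀ b, ‖Φ b‖ = ‖b‖) (v : G →* unitary B) :
    FullGroupCStar G →⋆ₐ[ℂ] B where
  __ := liftRingHom v (continuous_liftGroupAlg Φ hΦ v)
  commutes' c := by
    have h : (algebraMap ℂ (FullGroupCStar G) c) = incl (c • (1 : GroupAlg G)) := by
      rw [incl_smul, map_one, Algebra.algebraMap_eq_smul_one]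
    change liftRingHom v _ (algebraMap ℂ (FullGroupCStar G) c) = _
    rw [h, liftRingHom_incl, map_smul, map_one, Algebra.algebraMap_eq_smul_one]
  map_star' x := by
    have hc := continuous_liftRingHom v (continuous_liftGroupAlg Φ hΦ v)
    refine denseRange_incl.induction_on (p := fun x : FullGroupCStar G =>
      liftRingHom v (continuous_liftGroupAlg Φ hΦ v) (star x) =
        star (liftRingHom v (continuous_liftGroupAlg Φ hΦ v) x)) x ?_ fun f => ?_
    · exact isClosed_eq (hc.comp continuous_star_aux) (continuous_star.comp hc)
    · rw [star_incl, liftRingHom_incl, liftRingHom_incl, liftGroupAlg_star]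

theorem lift_of (Φ : B →⋆ₐ[ℂ] (H →L[ℂ] H)) (hΦ : ∀ b, ‖Φ b‖ = ‖b‖) (v : G →* unitary B)
    (g : G) : lift Φ hΦ v (of g) = (v g : B) :=
  (liftRingHom_incl v (continuous_liftGroupAlg Φ hΦ v) _).trans (liftGroupAlg_of v g)

/-- Topological induction on `C⋆(G)`: a closed additive property that holds on the multiples of
the group elements holds everywhere. -/
theorem induction_of {p : FullGroupCStar G → Prop} (hp : IsClosed {x | p x}) (zero : p 0)
    (smul_of : ∀ (c : ℂ) (g : G), p (c • of g))
    (add : ∀ x y, p x → p y → p (x + y)) (x : FullGroupCStar G) : p x := by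
  refine denseRange_incl.induction_on x hp fun f => ?_
  induction f using GroupAlg.induction_smul_of with
  | zero => rwa [map_zero]
  | smul_of c g => rw [incl_smul]; exact smul_of c g
  | add a b ha hb => rw [map_add]; exact add _ _ ha hb

theorem continuous_starAlgHom (φ : FullGroupCStar G →⋆ₐ[ℂ] B) : Continuous φ :=
  AddMonoidHomClass.continuous_of_bound φ 1 fun x => by
    simpa using NonUnitalStarAlgHom.norm_apply_le φ x

/-- A family of ⋆-homomorphisms on `C⋆(G)` depends continuously on a parameter as soon as it does
so on the group elements. -/
theorem continuous_family {X : Type*} [TopologicalSpace X] (φ : X → FullGroupCStar G →⋆ₐ[ℂ] B)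
    (hφ : ∀ g, Continuous fun t => φ t (of g)) (x : FullGroupCStar G) :
    Continuous fun t => φ t x := by
  refine induction_of (p := fun x => Continuous fun t => φ t x) ?_ ?_ ?_ ?_ x
  -- All `φ t` are contractive, so approximating `x` in norm approximates `t ↦ φ t x` uniformly in
  -- `t`, and uniform limits preserve continuity.
  · refine isClosed_of_closure_subset fun x hx => ?_
    refine continuous_of_uniform_approx_of_continuous fun U hU => ?_
    obtain ⟨ε, hε, hU⟩ := Metric.mem_uniformity_dist.1 hU
    obtain ⟨y, hy, hxy⟩ := Metric.mem_closure_iff.1 hx ε hε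
    refine ⟨fun t => φ t y, hy, fun t => hU ?_⟩
    rw [dist_eq_norm, ← map_sub]
    exact (NonUnitalStarAlgHom.norm_apply_le (φ t) (x - y)).trans_lt (by rwa [← dist_eq_norm])
  · simpa only [map_zero] using continuous_const
  · intro c g
    simp only [map_smul]
    exact (hφ g).const_smul c
  · intro x y hx hy
    simp only [map_add]
    exact Continuous.add hx hy

end FullGroupCStar

/-! ### Characters and matrix representations of `C⋆(G)` -/

namespace FullGroupCStar

variable {G : Type} [Group G]

theorem norm_starAlgHom_ofId (c : ℂ) : ‖StarAlgHom.ofId ℂ (ℂ →L[ℂ] ℂ) c‖ = ‖c‖ :=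
  norm_algebraMap' (ℂ →L[ℂ] ℂ) c

/-- The one-dimensional representation of `C⋆(G)` given by a unitary character of `G`. -/
def character (v : G →* unitary ℂ) : FullGroupCStar G →⋆ₐ[ℂ] ℂ :=
  lift (StarAlgHom.ofId ℂ (ℂ →L[ℂ] ℂ)) norm_starAlgHom_ofId v

theorem character_of (v : G →* unitary ℂ) (g : G) : character v (of g) = (v g : ℂ) :=
  lift_of _ _ v g

open scoped Matrix.Norms.L2Operator

/-- With the `ℓ²` operator norm, the action on Euclidean space is the isometric representation that
`lift` requires. -/
theorem norm_toEuclideanCLM_toStarAlgHom {k : ℕ} (A : Matrix (Fin k) (Fin k) ℂ) :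
    ‖(Matrix.toEuclideanCLM (n := Fin k) (𝕜 := ℂ)).toStarAlgHom A‖ = ‖A‖ :=
  Matrix.l2_opNorm_toEuclideanCLM A

/-- The representation of `C⋆(G)` by complex matrices given by a unitary representation of `G`. -/
def matrixRep {k : ℕ} (v : G →* unitary (Matrix (Fin k) (Fin k) ℂ)) :
    FullGroupCStar G →⋆ₐ[ℂ] Matrix (Fin k) (Fin k) ℂ :=
  lift (Matrix.toEuclideanCLM (n := Fin k) (𝕜 := ℂ)).toStarAlgHom
    norm_toEuclideanCLM_toStarAlgHom v

theorem matrixRep_of {k : ℕ} (v : G →* unitary (Matrix (Fin k) (Fin k) ℂ)) (g : G) :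
    matrixRep v (of g) = (v g : Matrix (Fin k) (Fin k) ℂ) :=
  lift_of _ _ v g

end FullGroupCStar

/-! ### Kernels of characters are maximal modular -/

section Kernel

variable {A : Type u} [CStarAlgebra A]

/-- The kernel has codimension one: if `φ a ≠ 0`, then `1` is a multiple of `a` modulo the kernel,
so a strictly larger ideal contains `1`. -/
theorem TwoSidedIdeal.isMaximalModular_ker (φ : A →⋆ₐ[ℂ] ℂ) :
    (TwoSidedIdeal.ker φ).IsMaximalModular := by
  refine ⟨⟨1, fun a => by simp⟩, fun h => ?_, fun I hI => ?_⟩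
  · have : (1 : A) ∈ TwoSidedIdeal.ker φ := by rw [h]; trivial
    rw [TwoSidedIdeal.mem_ker, map_one] at this
    exact one_ne_zero this
  · obtain ⟨hle, a, haI, ha⟩ := SetLike.lt_iff_le_and_exists.1 hI
    rw [TwoSidedIdeal.mem_ker] at ha
    have h1 : (1 : A) - (φ a)⁻¹ • a ∈ I := hle (by
      rw [TwoSidedIdeal.mem_ker, map_sub, map_smul, map_one, smul_eq_mul, inv_mul_cancel₀ ha,
        sub_self])
    -- Ideals here are ring ideals, so scaling is done by multiplying with a scalar multiple of `1`.
    have h2 : (φ a)⁻¹ • a ∈ I := by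
      simpa using I.mul_mem_left ((φ a)⁻¹ • (1 : A)) a haI
    have h3 : (1 : A) ∈ I := by simpa using I.add_mem h1 h2
    rw [eq_top_iff]
    intro x _
    simpa using I.mul_mem_left x 1 h3

end Kernel

/-! ### Homomorphisms out of the wallpaper group -/

namespace Wallpaper

/-- Twice the horizontal displacement of the origin. -/
def horiz (g : group) : ℤ := ⌊2 * ((g : ℂ ≃ᵢ ℂ) 0).re⌋

/-- The vertical displacement of the origin. -/
def vert (g : group) : ℤ := ⌊((g : ℂ ≃ᵢ ℂ) 0).im⌋

/-- The floors defining `horiz` and `vert` are exact, because `2x` and `y` are integers on the orbit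
of the origin. These numbers determine the element: `g = τ_{0,v} σʰ`. -/
theorem horiz_τ (m n : ℤ) : horiz (τ m n) = 2 * m := by
  have : 2 * (translation m n 0).re = ((2 * m : ℤ) : ℝ) := by simp [translation_apply]
  exact (congrArg Int.floor this).trans (Int.floor_intCast _)

theorem vert_τ (m n : ℤ) : vert (τ m n) = n := by
  have : (translation m n 0).im = (n : ℝ) := by simp [translation_apply]
  exact (congrArg Int.floor this).trans (Int.floor_intCast _)

theorem horiz_σ_mul_τ (m n : ℤ) : horiz (σ * τ m n) = 2 * m + 1 := by
  have : 2 * (glide (translation m n 0)).re = ((2 * m + 1 : ℤ) : ℝ) := by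
    simp [translation_apply, glide_apply]
    ring
  exact (congrArg Int.floor this).trans (Int.floor_intCast _)

theorem vert_σ_mul_τ (m n : ℤ) : vert (σ * τ m n) = -n := by
  have : (glide (translation m n 0)).im = ((-n : ℤ) : ℝ) := by
    simp [translation_apply, glide_apply]
  exact (congrArg Int.floor this).trans (Int.floor_intCast _)

theorem τ_zero_zero : τ 0 0 = 1 := by
  ext z
  change translation 0 0 z = z
  simp [translation_apply]

section Lift

variable {U : Type*} [Group U]

theorem zpow_conj {S D : U} (h : S * D = D⁻¹ * S) (n : ℤ) : S * D ^ n = D ^ (-n) * S := by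
  have : SemiconjBy S D D⁻¹ := h
  simpa using (this.zpow_right n).eq

/-- `S` inverts `D`, so `S²` commutes with it. -/
theorem zpow_comm {S D : U} (h : S * D = D⁻¹ * S) (m n : ℤ) :
    S ^ (2 * m) * D ^ n = D ^ n * S ^ (2 * m) := by
  have h2 : Commute (S ^ (2 : ℤ)) D := by
    have h1 : SemiconjBy S D D⁻¹ := h
    have h1' : SemiconjBy S D⁻¹ D := by simpa using h1.inv_right
    simpa [zpow_ofNat, sq, Commute] using h1'.mul_left h1
  rw [zpow_mul]
  exact (h2.zpow_zpow m n).eq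

/-- The homomorphism of the wallpaper group with `σ ↦ S` and `τ_{m,n} ↦ Dⁿ S²ᵐ`. -/
def lift (S D : U) (h : S * D = D⁻¹ * S) : group →* U :=
  MonoidHom.mk' (fun g => D ^ vert g * S ^ horiz g) fun a b => by
    have h2 (n : ℤ) : S * D ^ n = D ^ (-n) * S := zpow_conj h n
    have τσ (m n : ℤ) : τ m n * σ = σ * τ m (-n) := (σ_mul_τ m n).symm
    have σσ : σ * σ = τ 1 0 := by rw [← sq, σ_sq]
    have odd (m n : ℤ) : S ^ (2 * m + 1) * D ^ n = D ^ (-n) * S ^ (2 * m + 1) := by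
      rw [zpow_add_one, mul_assoc, h2, ← mul_assoc, zpow_comm h, mul_assoc]
    -- Multiplicativity depends on moving a power of `S` past a power of `D`: even powers commute,
    -- odd powers invert. Hence four cases.
    obtain ⟨m, n, rfl | rfl⟩ := eq_τ_or_eq_σ_mul_τ a <;>
    obtain ⟨m', n', rfl | rfl⟩ := eq_τ_or_eq_σ_mul_τ b
    · rw [τ_mul_τ]
      simp only [horiz_τ, vert_τ]
      rw [mul_assoc, ← mul_assoc (S ^ (2 * m)), zpow_comm h, mul_assoc, ← zpow_add, ← mul_assoc,
        ← zpow_add, mul_add]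
    · rw [← mul_assoc, τσ, mul_assoc, τ_mul_τ]
      simp only [horiz_τ, vert_τ, horiz_σ_mul_τ, vert_σ_mul_τ]
      rw [mul_assoc, ← mul_assoc (S ^ (2 * m)), zpow_comm h, mul_assoc, ← zpow_add, ← mul_assoc,
        ← zpow_add]
      congr 2 <;> ring
    · rw [mul_assoc, τ_mul_τ]
      simp only [horiz_τ, vert_τ, horiz_σ_mul_τ, vert_σ_mul_τ]
      rw [mul_assoc, ← mul_assoc (S ^ (2 * m + 1)), odd, mul_assoc, ← zpow_add, ← mul_assoc,
        ← zpow_add]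
      congr 2 <;> ring
    · rw [mul_assoc, ← mul_assoc (τ m n), τσ, mul_assoc, τ_mul_τ, ← mul_assoc, σσ, τ_mul_τ]
      simp only [horiz_τ, vert_τ, horiz_σ_mul_τ, vert_σ_mul_τ]
      rw [mul_assoc, ← mul_assoc (S ^ (2 * m + 1)), odd, mul_assoc, ← zpow_add, ← mul_assoc,
        ← zpow_add]
      congr 2 <;> ring

theorem lift_apply (S D : U) (h : S * D = D⁻¹ * S) (g : group) :
    lift S D h g = D ^ vert g * S ^ horiz g := rfl

theorem lift_τ (S D : U) (h : S * D = D⁻¹ * S) (m n : ℤ) :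
    lift S D h (τ m n) = D ^ n * S ^ (2 * m) := by
  rw [lift_apply, horiz_τ, vert_τ]

theorem lift_σ (S D : U) (h : S * D = D⁻¹ * S) : lift S D h σ = S := by
  have := horiz_σ_mul_τ 0 0
  have h' := vert_σ_mul_τ 0 0
  rw [τ_zero_zero, mul_one] at this h'
  rw [lift_apply, this, h']
  simp

end Lift

end Wallpaper

/-! ### Induced representations and their degeneration at `w = 1` -/

namespace Wallpaper

open FullGroupCStar

/-- The character of the wallpaper group with `σ ↦ α` and `τ_{0,n} ↦ 1`. -/
def glideChar (α : unitary ℂ) : group →* unitary ℂ := lift α 1 (by simp)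

/-- The unitary matrix of the glide reflection in the representation induced from a character of
the translation group. -/
def glideMatrix (α : unitary ℂ) : unitary (Matrix (Fin 2) (Fin 2) ℂ) :=
  ⟨!![0, (α : ℂ) ^ 2; 1, 0], by
    have h1 : (starRingEnd ℂ) (α : ℂ) * (α : ℂ) = 1 := Unitary.coe_star_mul_self α
    have h2 : (starRingEnd ℂ) (α : ℂ) ^ 2 * (α : ℂ) ^ 2 = 1 := by rw [← mul_pow, h1, one_pow]
    rw [Unitary.mem_iff]
    constructor <;> ext i j <;> fin_cases i <;> fin_cases j <;>
      simp [Matrix.mul_apply, Matrix.star_apply, Fin.sum_univ_two, h2,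
        mul_comm ((α : ℂ) ^ 2)]⟩

/-- The unitary matrix `diag(w, w̄)`. -/
def transMatrix (w : unitary ℂ) : unitary (Matrix (Fin 2) (Fin 2) ℂ) :=
  ⟨!![(w : ℂ), 0; 0, star (w : ℂ)], by
    have h1 : (starRingEnd ℂ) (w : ℂ) * (w : ℂ) = 1 := Unitary.coe_star_mul_self w
    rw [Unitary.mem_iff]
    constructor <;> ext i j <;> fin_cases i <;> fin_cases j <;>
      simp [Matrix.mul_apply, Matrix.star_apply, Fin.sum_univ_two, h1, mul_comm (w : ℂ)]⟩

theorem glideMatrix_mul_transMatrix (α w : unitary ℂ) :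
    glideMatrix α * transMatrix w = (transMatrix w)⁻¹ * glideMatrix α := by
  rw [← Unitary.star_eq_inv]
  ext i j
  fin_cases i <;> fin_cases j <;>
    simp [glideMatrix, transMatrix, Matrix.mul_apply, Matrix.star_apply, Fin.sum_univ_two,
      mul_comm]

/-- The representation of the wallpaper group induced from the character
`τ_{m,n} ↦ α²ᵐ wⁿ` of the translation group. -/
def inducedRep (α w : unitary ℂ) : group →* unitary (Matrix (Fin 2) (Fin 2) ℂ) :=
  lift (glideMatrix α) (transMatrix w) (glideMatrix_mul_transMatrix α w)

open scoped Matrix.Norms.L2Operator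

theorem continuous_transMatrix : Continuous transMatrix := by
  refine Continuous.subtype_mk ?_ _
  refine continuous_matrix fun i j => ?_
  fin_cases i <;> fin_cases j <;> simp <;> fun_prop

theorem continuous_inducedRep (α : unitary ℂ) (g : group) :
    Continuous fun w => inducedRep α w g := by
  simp only [inducedRep, lift_apply]
  exact (continuous_transMatrix.zpow _).mul continuous_const

/-- A matrix commuting with `diag(w, w̄)` has vanishing lower left entry when `w² ≠ 1`. -/
theorem lowerEntry_eq_zero {w : unitary ℂ} (hw : (w : ℂ) ≠ star (w : ℂ))
    {M : Matrix (Fin 2) (Fin 2) ℂ}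
    (h : M * (transMatrix w : Matrix (Fin 2) (Fin 2) ℂ) = transMatrix w * M) : M 1 0 = 0 := by
  have h10 : M 1 0 * (w : ℂ) = star (w : ℂ) * M 1 0 := by
    simpa [transMatrix, Matrix.mul_apply, Fin.sum_univ_two] using congrFun (congrFun h 1) 0
  refine (mul_eq_zero.1 (?_ : ((w : ℂ) - star (w : ℂ)) * M 1 0 = 0)).resolve_left
    (sub_ne_zero.2 hw)
  linear_combination h10

/-- The points of the unit circle are unitary elements of `ℂ`. -/
def ofCircle (w : Circle) : unitary ℂ :=
  ⟨w, by
    rw [Unitary.mem_iff_star_mul_self]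
    change (starRingEnd ℂ) (w : ℂ) * (w : ℂ) = 1
    rw [← Complex.normSq_eq_conj_mul_self, Circle.normSq_coe, Complex.ofReal_one]⟩

theorem continuous_ofCircle : Continuous ofCircle :=
  Continuous.subtype_mk continuous_subtype_val _

theorem ofCircle_one : ofCircle 1 = 1 := Subtype.ext Circle.coe_one

theorem ofCircle_exp_ne_star {t : ℝ} (ht : t ∈ Set.Ioo 0 Real.pi) :
    (ofCircle (Circle.exp t) : ℂ) ≠ star (ofCircle (Circle.exp t) : ℂ) := by
  intro h
  have him : (Complex.exp (t * Complex.I)).im = 0 := by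
    have := congrArg Complex.im h
    change (Circle.exp t : ℂ).im = ((starRingEnd ℂ) (Circle.exp t : ℂ)).im at this
    rw [Complex.conj_im, Circle.coe_exp] at this
    linarith
  rw [Complex.exp_ofReal_mul_I_im] at him
  exact (Real.sin_pos_of_mem_Ioo ht).ne' him

/-- The representation of `C⋆(G)` induced from the character `τ_{m,n} ↦ α²ᵐ wⁿ`. -/
def rep (α w : unitary ℂ) :
    FullGroupCStar group →⋆ₐ[ℂ] Matrix (Fin 2) (Fin 2) ℂ :=
  matrixRep (inducedRep α w)

theorem rep_τ (α w : unitary ℂ) : rep α w (of (τ 0 1)) = transMatrix w := by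
  rw [rep, matrixRep_of, inducedRep, lift_τ]
  simp

theorem continuous_rep (α : unitary ℂ) (x : FullGroupCStar group) :
    Continuous fun w => rep α w x := by
  refine continuous_family (rep α) (fun g => ?_) x
  simp only [rep, matrixRep_of]
  exact continuous_subtype_val.comp (continuous_inducedRep α g)

/-- Central elements act by upper triangular matrices in the representation induced from a
character that is fixed by the glide reflection, since they act by diagonal matrices in nearby
irreducible representations. -/
theorem rep_one_lowerEntry (α : unitary ℂ) {c : FullGroupCStar group}
    (hc : c ∈ Set.center (FullGroupCStar group)) : rep α 1 c 1 0 = 0 := by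
  have hcont : Continuous fun t : ℝ => rep α (ofCircle (Circle.exp t)) c :=
    (continuous_rep α c).comp (continuous_ofCircle.comp Circle.exp.continuous)
  have hclosed : IsClosed {t : ℝ | rep α (ofCircle (Circle.exp t)) c 1 0 = 0} :=
    isClosed_eq (hcont.matrix_elem 1 0) continuous_const
  have hsub : Set.Ioo 0 Real.pi ⊆ {t : ℝ | rep α (ofCircle (Circle.exp t)) c 1 0 = 0} :=
    fun t ht => by
      refine lowerEntry_eq_zero (ofCircle_exp_ne_star ht) ?_
      rw [← rep_τ α, ← map_mul, ← map_mul, (hc.comm _).eq]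
  -- The parameter `w = 1` is `t = 0`, an endpoint of the interval on which `e^{it}` is not real.
  have h0 : (0 : ℝ) ∈ closure (Set.Ioo 0 Real.pi) := by
    rw [closure_Ioo Real.pi_pos.ne]
    exact ⟨le_rfl, Real.pi_pos.le⟩
  have := closure_minimal hsub hclosed h0
  simpa only [Set.mem_ofPred_eq, Circle.exp_zero, ofCircle_one] using this

/-- The character with `σ ↦ β` is a subrepresentation of the representation induced from its
restriction to the translation group. -/
theorem rep_one_mulVec {α β : unitary ℂ} (h : (β : ℂ) ^ 2 = (α : ℂ) ^ 2)
    (x : FullGroupCStar group) :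
    (rep α 1 x).mulVec ![(β : ℂ), 1] = character (glideChar β) x • ![(β : ℂ), 1] := by
  have hS : (glideMatrix α : Matrix (Fin 2) (Fin 2) ℂ).mulVec ![(β : ℂ), 1] =
      (β : ℂ) • ![(β : ℂ), 1] := by
    ext i
    fin_cases i <;> simp [glideMatrix, ← h, sq]
  have hT : transMatrix 1 = 1 := by
    ext i j
    fin_cases i <;> fin_cases j <;> simp [transMatrix]
  have hpow (k : ℤ) : ((glideMatrix α ^ k : unitary _) : Matrix (Fin 2) (Fin 2) ℂ).mulVec
      ![(β : ℂ), 1] = ((β ^ k : unitary ℂ) : ℂ) • ![(β : ℂ), 1] := by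
    have hsucc (k : ℤ) : ((glideMatrix α ^ (k + 1) : unitary _) :
        Matrix (Fin 2) (Fin 2) ℂ).mulVec ![(β : ℂ), 1] =
          (β : ℂ) • ((glideMatrix α ^ k : unitary _) :
            Matrix (Fin 2) (Fin 2) ℂ).mulVec ![(β : ℂ), 1] := by
      rw [zpow_add_one, Submonoid.coe_mul, ← Matrix.mulVec_mulVec, hS, Matrix.mulVec_smul]
    have hsucc' (k : ℤ) : ((β ^ (k + 1) : unitary ℂ) : ℂ) = (β : ℂ) * (β ^ k : unitary ℂ) := by
      rw [zpow_add_one, Submonoid.coe_mul, mul_comm]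
    have hβ : (β : ℂ) ≠ 0 := fun h0 => by
      have h1 : star (β : ℂ) * (β : ℂ) = 1 := Unitary.coe_star_mul_self β
      rw [h0, mul_zero] at h1
      exact zero_ne_one h1
    induction k using Int.induction_on with
    | zero => simp
    | succ k ih => rw [hsucc, ih, hsucc', smul_smul]
    -- Downward, the relation at `-k` is `β` times the relation at `-k - 1`, and `β ≠ 0` cancels.
    | pred k ih =>
      rw [← sub_add_cancel (-(k : ℤ)) 1, hsucc, hsucc', mul_smul] at ih
      exact smul_right_injective _ hβ ih
  refine induction_of (p := fun x => (rep α 1 x).mulVec ![(β : ℂ), 1] =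
    character (glideChar β) x • ![(β : ℂ), 1]) ?_ ?_ ?_ ?_ x
  · exact isClosed_eq
      ((continuous_starAlgHom (rep α 1)).matrix_mulVec continuous_const)
      ((continuous_starAlgHom (character (glideChar β))).smul continuous_const)
  · simp
  · intro c g
    -- Vertical translations act trivially on both sides, leaving only the power `horiz g` of the
    -- glide.
    rw [map_smul, map_smul, Matrix.smul_mulVec, character_of, rep, matrixRep_of, inducedRep,
      lift_apply, glideChar, lift_apply, hT, one_zpow, one_zpow, one_mul, one_mul, hpow, smul_assoc]
  · intro x y hx hy
    simp only [map_add, Matrix.add_mulVec, add_smul, hx, hy]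

/-- The lower row is `(0, *)` on central elements, so the second coordinate of `rep_one_mulVec`
gives the value. The right side does not involve `β`, which forces both square roots of `α²` to give
the same value. -/
theorem character_eq_rep {α β : unitary ℂ} (h : (β : ℂ) ^ 2 = (α : ℂ) ^ 2)
    {c : FullGroupCStar group} (hc : c ∈ Set.center (FullGroupCStar group)) :
    character (glideChar β) c = rep α 1 c 1 1 := by
  have := congrFun (rep_one_mulVec h c) 1
  simpa [Matrix.mulVec, dotProduct, Fin.sum_univ_two, rep_one_lowerEntry α hc] using this.symm

theorem character_neg_eq (α : unitary ℂ) {c : FullGroupCStar group}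
    (hc : c ∈ Set.center (FullGroupCStar group)) :
    character (glideChar α) c = character (glideChar (-α)) c := by
  rw [character_eq_rep (α := α) rfl hc, character_eq_rep (α := α) (neg_sq (α : ℂ)) hc]

theorem character_char_σ (β : unitary ℂ) : character (glideChar β) (of σ) = (β : ℂ) := by
  rw [character_of, glideChar, lift_σ]

/-- The element `σ - α` is killed by the first character and sent to `-2α ≠ 0` by the second. -/
theorem ker_character_ne (α : unitary ℂ) :
    TwoSidedIdeal.ker (character (glideChar α)) ≠
      TwoSidedIdeal.ker (character (glideChar (-α))) := by
  intro h
  have hmem : of σ - algebraMap ℂ _ (α : ℂ) ∈ TwoSidedIdeal.ker (character (glideChar α)) := by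
    rw [TwoSidedIdeal.mem_ker, map_sub, character_char_σ, AlgHomClass.commutes]
    simp
  rw [h, TwoSidedIdeal.mem_ker, map_sub, character_char_σ, AlgHomClass.commutes] at hmem
  have h2 : (2 : ℂ) * (α : ℂ) = 0 := by
    have h3 : -(α : ℂ) - (α : ℂ) = 0 := hmem
    linear_combination -h3
  have h1 : star (α : ℂ) * (α : ℂ) = 1 := Unitary.coe_star_mul_self α
  rw [(mul_eq_zero.1 h2).resolve_left two_ne_zero, mul_zero] at h1
  exact zero_ne_one h1

end Wallpaper

end

/-! ### Failure of weak centrality -/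

open Wallpaper FullGroupCStar in
theorem mainTheorem8 :
    ¬ IsWeaklyCentral (FullGroupCStar Wallpaper.group) ∧
    ∀ α : Circle, ∃ π₁ π₂ : FullGroupCStar Wallpaper.group →⋆ₐ[ℂ] ℂ,
      π₁ (FullGroupCStar.of Wallpaper.σ) = (α : ℂ) ∧
      π₂ (FullGroupCStar.of Wallpaper.σ) = -(α : ℂ) ∧
      (TwoSidedIdeal.ker π₁).IsMaximalModular ∧
      (TwoSidedIdeal.ker π₂).IsMaximalModular ∧
      TwoSidedIdeal.ker π₁ ≠ TwoSidedIdeal.ker π₂ ∧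
      ∃ J : Ideal (Subalgebra.center ℂ (FullGroupCStar Wallpaper.group)), J.IsMaximal ∧
        J = (RingHom.ker π₁).comap
          (Subalgebra.center ℂ (FullGroupCStar Wallpaper.group)).val ∧
        J = (RingHom.ker π₂).comap
          (Subalgebra.center ℂ (FullGroupCStar Wallpaper.group)).val := by
  constructor
  -- It is injectivity that fails, already for the pair `σ ↦ 1`, `σ ↦ -1`.
  · rintro ⟨hinj, -⟩
    refine ker_character_ne 1 (hinj _ _ (TwoSidedIdeal.isMaximalModular_ker _)
      (TwoSidedIdeal.isMaximalModular_ker _) ?_)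
    ext c
    refine and_congr_left fun hc => ?_
    change c ∈ TwoSidedIdeal.ker _ ↔ c ∈ TwoSidedIdeal.ker _
    rw [TwoSidedIdeal.mem_ker, TwoSidedIdeal.mem_ker, character_neg_eq 1 hc]
  · intro α
    refine ⟨character (glideChar (ofCircle α)), character (glideChar (-ofCircle α)),
      character_char_σ _, character_char_σ _, TwoSidedIdeal.isMaximalModular_ker _,
      TwoSidedIdeal.isMaximalModular_ker _, ker_character_ne _, _, ?_, rfl, ?_⟩
    -- The center contains the scalars, so the restricted character is still onto the field `ℂ`.
    · refine RingHom.ker_isMaximal_of_surjective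
        ((character (glideChar (ofCircle α)) : FullGroupCStar group →+* ℂ).comp
          (Subalgebra.center ℂ (FullGroupCStar group)).val.toRingHom) fun c => ?_
      refine ⟨algebraMap ℂ _ c, ?_⟩
      change character (glideChar (ofCircle α)) (algebraMap ℂ _ c) = c
      rw [AlgHomClass.commutes]
      rfl
    · ext c
      change character (glideChar (ofCircle α)) (c : FullGroupCStar group) = 0 ↔
        character (glideChar (-ofCircle α)) (c : FullGroupCStar group) = 0
      rw [character_neg_eq (ofCircle α) c.2]
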